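/- An MV-algebra is an algebra $(A,\oplus,\neg,0)$ such that $(A,\oplus,0)$ is a commutative monoid and $\neg\neg x=x$, $x\oplus\neg 0=\neg 0$, $\neg(\neg x\oplus y)\oplus y=\neg(\neg y\oplus x)\oplus x$. Put $1=\neg 0$, $x\ominus y=\neg(\neg x\oplus y)$, $d(x,y)=(x\ominus y)\oplus(y\ominus x)$, and $x\le y$ iff $x\oplus z=y$ for some $z$. An MV-chain is an MV-algebra with $1\ne 0$ whose order is total. An ideal is a subset that contains $0$, is downward closed and is closed under $\oplus$; it is proper if it does not contain $1$, and a proper ideal $P$ is prime if for all $x,y$ one of $x\ominus y$, $y\ominus x$ lies in $P$. The quotient $A/I$ is taken by the congruence $d(x,y)\in I$. An MV-algebra is simple if $1\neq0$ and $\{0\}$ is its only proper ideal, and hyperarchimedean if for every $a\in A$ there is an integer $n\ge 1$ with $na=(n+1)a$. An mv-space is a pair $(X,E)$ of a topological space $X$ and a sheaf (étale space) $E\to X$ of MV-chains on $X$: the fibers $E_x$ are MV-chains, and the sections over each open set are closed under the pointwise operations. A morphism $(X,E)\to(Y,F)$ of mv-spaces is a continuous map $f:X\to Y$ together with MV-morphisms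 $\varphi_x:F_{f(x)}\to E_x$ ($x\in X$) such that for every open $V\subseteq Y$ and every section $s$ of $F$ over $V$, $x\mapsto\varphi_x(s(f(x)))$ is a section of $E$ over $f^{-1}(V)$. For an MV-algebra $A$, $\mathrm{Spec}(A)=(Z_A,E_A)$ is the mv-space where $Z_A$ is the set of prime ideals of $A$ with the topology that has the sets $W_a=\{P: a\in P\}$ $(a\in A)$ as a base, and $E_A=\bigsqcup_{P\in Z_A}A/P$, with the sets $\{[a]_P: P\in W_b\}$ $(a,b\in A)$ as a base of open sets; a morphism $g:A\to B$ is sent to $P\mapsto g^{-1}(P)$ with the induced maps $A/g^{-1}(P)\to B/P$. For an mv-space $(X,E)$, $\Gamma(X,E)$ is the MV-algebra of global sections of $E$; a morphism $(f,\varphi)$ is sent to $s\mapsto(x\mapsto\varphi_x(s(f(x))))$. **Theorem.** The contravariant functors $\mathrm{Spec}$, from MV-algebras to mv-spaces, and $\Gamma$, from mv-spaces to MV-algebras, restrict to functors between the hyperarchimedean MV-algebras and the mv-spaces $(X,E)$ that are global Hausdorff sheaves of simple MV-algebras over Stone spaces (that is: $X$ is compact Hausdorff with a base of clopen sets, the space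 $E$ is Hausdorff, every fiber $E_x$ is simple, and every point of $E$ is a value of a global section). These restrictions are mutually quasi-inverse: they give an equivalence between the opposite of the category of hyperarchimedean MV-algebras and the full subcategory of such mv-spaces. -/

import Mathlib

open CategoryTheory Opposite TopologicalSpace

universe u

/-! ### MV-algebras -/

/-- An MV-algebra. The operation `⊕` is written `+`, the negation `¬ x` is written `xᶜ`;
the constant `1` is `0ᶜ`, and `n • x` is the `n`-fold sum `x ⊕ ⋯ ⊕ x`. -/
class MVAlgebra (A : Type u) extends AddCommMonoid A, Compl A where
  compl_compl (x : A) : xᶜᶜ = x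
  add_one (x : A) : x + 0ᶜ = 0ᶜ
  lukasiewicz (x y : A) : (xᶜ + y)ᶜ + y = (yᶜ + x)ᶜ + x

namespace MVAlgebra

variable {A : Type u} [MVAlgebra A]

/-- `x ⊙ y = ¬(¬x ⊕ ¬y)` -/
def odot (x y : A) : A := (xᶜ + yᶜ)ᶜ

/-- `x ⊖ y = x ⊙ ¬y` -/
def ominus (x y : A) : A := odot x yᶜ

/-- The order of an MV-algebra: `x ≤ y` iff `x ⊕ z = y` for some `z`. -/
def Le (x y : A) : Prop := ∃ z, x + z = y

/-- The distance `d(x, y) = (x ⊖ y) ⊕ (y ⊖ x)`. -/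
def distance (x y : A) : A := ominus x y + ominus y x

theorem ominus_eq (x y : A) : ominus x y = (xᶜ + y)ᶜ := by
  simp [ominus, odot, compl_compl]

theorem compl_add_self (x : A) : xᶜ + x = 0ᶜ := by
  have h := lukasiewicz (0 : A) x
  have h1 := lukasiewicz (0ᶜ : A) x
  simp only [compl_compl, zero_add, add_zero] at h h1
  rw [add_comm (0ᶜ : A) x, add_one, compl_compl, zero_add] at h
  rw [add_one] at h1
  exact h1

theorem le_iff (x y : A) : Le x y ↔ xᶜ + y = 0ᶜ := by
  constructor
  · rintro ⟨z, rfl⟩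
    rw [← add_assoc, compl_add_self, add_comm, add_one]
  · intro h
    refine ⟨(yᶜ + x)ᶜ, ?_⟩
    have h1 := lukasiewicz x y
    rw [h, compl_compl, zero_add] at h1
    rw [add_comm]
    exact h1.symm

theorem le_iff_ominus (x y : A) : Le x y ↔ ominus x y = 0 := by
  rw [le_iff, ominus_eq]
  constructor
  · intro h; rw [h, compl_compl]
  · intro h; rw [← h, compl_compl]

theorem ominus_self (x : A) : ominus x x = 0 := (le_iff_ominus x x).1 ⟨0, add_zero x⟩

theorem le_trans {x y z : A} (h : Le x y) (h2 : Le y z) : Le x z := by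
  obtain ⟨a, rfl⟩ := h
  obtain ⟨b, rfl⟩ := h2
  exact ⟨a + b, (add_assoc x a b).symm⟩

theorem add_le_add {x y z w : A} (h : Le x y) (h2 : Le z w) : Le (x + z) (y + w) := by
  obtain ⟨a, rfl⟩ := h
  obtain ⟨b, rfl⟩ := h2
  exact ⟨a + b, add_add_add_comm x z a b⟩

theorem ominus_le_iff (x y z : A) : Le (ominus x z) y ↔ Le x (y + z) := by
  rw [le_iff, le_iff, ominus_eq, compl_compl, add_assoc, add_comm z y]

theorem le_ominus_add (x y : A) : Le x (ominus x y + y) :=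
  (ominus_le_iff x _ y).1 ⟨0, add_zero _⟩

theorem ominus_triangle (x y z : A) : Le (ominus x z) (ominus x y + ominus y z) := by
  rw [ominus_le_iff, add_assoc]
  exact le_trans (le_ominus_add x y) (add_le_add ⟨0, add_zero _⟩ (le_ominus_add y z))

theorem ominus_add_add (x y z w : A) :
    Le (ominus (x + z) (y + w)) (ominus x y + ominus z w) := by
  rw [ominus_le_iff, add_add_add_comm]
  exact add_le_add (le_ominus_add x y) (le_ominus_add z w)

theorem ominus_compl (x y : A) : ominus xᶜ yᶜ = ominus y x := by
  rw [ominus_eq, ominus_eq, compl_compl, add_comm]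

theorem distance_comm (x y : A) : distance x y = distance y x := add_comm _ _

theorem distance_self (x : A) : distance x x = 0 := by
  simp [distance, ominus_self]

theorem distance_triangle (x y z : A) : Le (distance x z) (distance x y + distance y z) := by
  have h := add_le_add (ominus_triangle x y z) (ominus_triangle z y x)
  have e : distance x y + distance y z =
      (ominus x y + ominus y z) + (ominus z y + ominus y x) := by
    unfold distance; abel
  rw [e]; exact h

theorem distance_add_add (x y z w : A) :
    Le (distance (x + z) (y + w)) (distance x y + distance z w) := by
  have h := add_le_add (ominus_add_add x y z w) (ominus_add_add y x w z)
  have e : distance x y + distance z w =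
      (ominus x y + ominus z w) + (ominus y x + ominus w z) := by
    unfold distance; abel
  rw [e]; exact h

theorem distance_compl (x y : A) : distance xᶜ yᶜ = distance x y := by
  rw [distance, ominus_compl, ominus_compl, add_comm]; rfl

theorem distance_zero (x : A) : distance x 0 = x := by
  have h : ominus (0 : A) x = 0 := (le_iff_ominus _ _).1 ⟨x, zero_add x⟩
  rw [distance, h, add_zero, ominus_eq, add_zero, compl_compl]

variable (A) in
/-- An MV-chain: a nontrivial MV-algebra whose order is total. -/
def IsChain : Prop := (0 : A)ᶜ ≠ 0 ∧ ∀ x y : A, Le x y ∨ Le y x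

variable (A) in
/-- Every element is archimedean: `n a = (n + 1) a` for some `n ≥ 1`. -/
def IsHyperarchimedean : Prop := ∀ a : A, ∃ n : ℕ, 1 ≤ n ∧ n • a = (n + 1) • a

end MVAlgebra

section

open MVAlgebra

/-- Morphisms of MV-algebras: maps preserving `0`, `⊕` and `¬`. -/
structure MVHom (A B : Type u) [MVAlgebra A] [MVAlgebra B] extends A →+ B where
  map_compl' (x : A) : toFun xᶜ = (toFun x)ᶜ

namespace MVHom

variable {A B C : Type u} [MVAlgebra A] [MVAlgebra B] [MVAlgebra C]

instance : FunLike (MVHom A B) A B where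
  coe f := f.toFun
  coe_injective f g h := by
    obtain ⟨⟨⟨f, _⟩, _⟩, _⟩ := f
    obtain ⟨⟨⟨g, _⟩, _⟩, _⟩ := g
    cases h
    rfl

@[ext] theorem ext {f g : MVHom A B} (h : ∀ x, f x = g x) : f = g := DFunLike.ext f g h

theorem map_zero (f : MVHom A B) : f 0 = 0 := f.map_zero'

theorem map_add (f : MVHom A B) (x y : A) : f (x + y) = f x + f y := f.map_add' x y

theorem map_compl (f : MVHom A B) (x : A) : f xᶜ = (f x)ᶜ := f.map_compl' x

theorem map_ominus (f : MVHom A B) (x y : A) : f (ominus x y) = ominus (f x) (f y) := by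
  simp only [ominus_eq, map_compl, map_add]

theorem map_distance (f : MVHom A B) (x y : A) : f (distance x y) = distance (f x) (f y) := by
  simp only [distance, map_ominus, map_add]

/-- The identity morphism. -/
def id (A : Type u) [MVAlgebra A] : MVHom A A where
  toFun x := x
  map_zero' := rfl
  map_add' _ _ := rfl
  map_compl' _ := rfl

/-- Composition of morphisms. -/
def comp (g : MVHom B C) (f : MVHom A B) : MVHom A C where
  toFun x := g (f x)
  map_zero' := by rw [f.map_zero, g.map_zero]
  map_add' x y := by rw [f.map_add, g.map_add]
  map_compl' x := by rw [f.map_compl, g.map_compl]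

end MVHom

/-! ### Ideals, quotients, prime ideals, simple algebras -/

/-- Ideals of an MV-algebra. -/
structure MVIdeal (A : Type u) [MVAlgebra A] where
  carrier : Set A
  zero_mem : 0 ∈ carrier
  lower {x y : A} : x ∈ carrier → Le y x → y ∈ carrier
  add_mem {x y : A} : x ∈ carrier → y ∈ carrier → x + y ∈ carrier

namespace MVIdeal

variable {A B : Type u} [MVAlgebra A] [MVAlgebra B]

instance : Membership A (MVIdeal A) := ⟨fun I x => x ∈ I.carrier⟩

/-- A prime ideal: proper, and `x ⊖ y` or `y ⊖ x` belongs to it for all `x`, `y`. -/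
def IsPrime (P : MVIdeal A) : Prop :=
  (0 : A)ᶜ ∉ P ∧ ∀ x y : A, ominus x y ∈ P ∨ ominus y x ∈ P

theorem add_mem_iff (I : MVIdeal A) (x y : A) : x + y ∈ I ↔ x ∈ I ∧ y ∈ I :=
  ⟨fun h => ⟨I.lower h ⟨y, rfl⟩, I.lower h ⟨x, add_comm y x⟩⟩, fun h => I.add_mem h.1 h.2⟩

/-- The congruence of an ideal: `x ∼ y` iff `d(x, y) ∈ I`. -/
def setoid (I : MVIdeal A) : Setoid A where
  r x y := distance x y ∈ I
  iseqv :=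
    { refl := fun x => by rw [distance_self]; exact I.zero_mem
      symm := fun {x y} h => by rw [distance_comm]; exact h
      trans := fun {x y z} h h2 => I.lower (I.add_mem h h2) (distance_triangle x y z) }

/-- The quotient `A/I`. -/
def Quot (I : MVIdeal A) : Type u := Quotient I.setoid

/-- The class `[x]_I` of `x` in `A/I`. -/
def cls (I : MVIdeal A) (x : A) : I.Quot := Quotient.mk I.setoid x

theorem cls_surjective (I : MVIdeal A) : Function.Surjective I.cls := Quotient.exists_rep

theorem cls_eq_cls (I : MVIdeal A) {x y : A} : I.cls x = I.cls y ↔ distance x y ∈ I :=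
  ⟨fun h => Quotient.exact h, fun h => Quotient.sound h⟩

instance (I : MVIdeal A) : Zero I.Quot := ⟨I.cls 0⟩

instance (I : MVIdeal A) : Add I.Quot :=
  ⟨Quotient.map₂ (fun x y : A => x + y) (fun x y h z w h2 =>
    I.lower (I.add_mem h h2) (distance_add_add x y z w))⟩

instance (I : MVIdeal A) : Compl I.Quot :=
  ⟨Quotient.map (fun x : A => xᶜ) (fun x y h => by
    change distance xᶜ yᶜ ∈ I
    rw [distance_compl]; exact h)⟩

instance (I : MVIdeal A) : MVAlgebra I.Quot where
  nsmul := nsmulRec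
  add_assoc := by rintro ⟨x⟩ ⟨y⟩ ⟨z⟩; exact congrArg I.cls (add_assoc x y z)
  add_comm := by rintro ⟨x⟩ ⟨y⟩; exact congrArg I.cls (add_comm x y)
  zero_add := by rintro ⟨x⟩; exact congrArg I.cls (zero_add x)
  add_zero := by rintro ⟨x⟩; exact congrArg I.cls (add_zero x)
  compl_compl := by rintro ⟨x⟩; exact congrArg I.cls (MVAlgebra.compl_compl x)
  add_one := by rintro ⟨x⟩; exact congrArg I.cls (MVAlgebra.add_one x)
  lukasiewicz := by rintro ⟨x⟩ ⟨y⟩; exact congrArg I.cls (MVAlgebra.lukasiewicz x y)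

theorem cls_zero (I : MVIdeal A) : I.cls 0 = 0 := rfl

theorem cls_add (I : MVIdeal A) (x y : A) : I.cls (x + y) = I.cls x + I.cls y := rfl

theorem cls_compl (I : MVIdeal A) (x : A) : I.cls xᶜ = (I.cls x)ᶜ := rfl

theorem cls_ominus (I : MVIdeal A) (x y : A) : I.cls (ominus x y) = ominus (I.cls x) (I.cls y) := rfl

theorem cls_eq_zero (I : MVIdeal A) {x : A} : I.cls x = 0 ↔ x ∈ I := by
  rw [← cls_zero, cls_eq_cls, distance_zero]

theorem IsPrime.isChain {P : MVIdeal A} (hP : P.IsPrime) : IsChain P.Quot := by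
  refine ⟨?_, fun x y => ?_⟩
  · rw [← cls_zero, ← cls_compl]
    exact fun h => hP.1 (P.cls_eq_zero.1 h)
  · obtain ⟨x, rfl⟩ := P.cls_surjective x
    obtain ⟨y, rfl⟩ := P.cls_surjective y
    rw [le_iff_ominus, le_iff_ominus, ← cls_ominus, ← cls_ominus, cls_eq_zero, cls_eq_zero]
    exact hP.2 x y

/-- The inverse image of an ideal under a morphism. -/
def comap (f : MVHom A B) (I : MVIdeal B) : MVIdeal A where
  carrier := {x | f x ∈ I}
  zero_mem := by
    change f 0 ∈ I
    rw [f.map_zero]; exact I.zero_mem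
  lower := by
    rintro x y h ⟨z, rfl⟩
    refine I.lower h ⟨f z, (f.map_add y z).symm⟩
  add_mem {x y} h h2 := by
    change f (x + y) ∈ I
    rw [f.map_add]; exact I.add_mem h h2

theorem mem_comap (f : MVHom A B) (I : MVIdeal B) (x : A) : x ∈ comap f I ↔ f x ∈ I := Iff.rfl

theorem IsPrime.comap {P : MVIdeal B} (hP : P.IsPrime) (f : MVHom A B) :
    (MVIdeal.comap f P).IsPrime := by
  refine ⟨?_, fun x y => ?_⟩
  · rw [mem_comap, f.map_compl, f.map_zero]; exact hP.1
  · rw [mem_comap, mem_comap, f.map_ominus, f.map_ominus]; exact hP.2 _ _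

/-- The morphism `A/f⁻¹(I) → B/I` induced by `f : A → B`, `[a] ↦ [f a]`. -/
def quotMap (f : MVHom A B) (I : MVIdeal B) : MVHom (comap f I).Quot I.Quot where
  toFun := Quotient.map f (fun x y h => by
    change distance (f x) (f y) ∈ I
    rw [← f.map_distance]; exact h)
  map_zero' := congrArg I.cls f.map_zero
  map_add' := by rintro ⟨x⟩ ⟨y⟩; exact congrArg I.cls (f.map_add x y)
  map_compl' := by rintro ⟨x⟩; exact congrArg I.cls (f.map_compl x)

theorem quotMap_cls (f : MVHom A B) (I : MVIdeal B) (x : A) :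
    quotMap f I ((comap f I).cls x) = I.cls (f x) := rfl

end MVIdeal

/-- A simple MV-algebra: nontrivial, and `{0}` is its only proper ideal. -/
def MVAlgebra.IsSimple (A : Type u) [MVAlgebra A] : Prop :=
  (0 : A)ᶜ ≠ 0 ∧ ∀ I : MVIdeal A, (0 : A)ᶜ ∉ I → ∀ x ∈ I, x = 0

/-! ### The category of MV-algebras -/

/-- Bundled MV-algebras. -/
structure MVAlgCat : Type (u + 1) where
  carrier : Type u
  [str : MVAlgebra carrier]

attribute [instance] MVAlgCat.str

instance : Category.{u} MVAlgCat.{u} where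
  Hom A B := MVHom A.carrier B.carrier
  id A := MVHom.id A.carrier
  comp f g := MVHom.comp g f

/-! ### The category of mv-spaces -/

/-- An mv-space `(X, E → X)`: a topological space `X` with an étale space `E → X` whose fibers
are MV-chains, such that the sections over each open set form a subalgebra of the
product of the fibers. The étale space is given by its fibers `stalk x`, a topology on the
disjoint union `E` of the fibers, for which the projection to `X` is a local homeomorphism. -/
structure MVSpace : Type (u + 1) where
  carrier : Type u
  [top : TopologicalSpace carrier]
  stalk : carrier → Type u
  [algebra : ∀ x, MVAlgebra (stalk x)]
  isChain : ∀ x, IsChain (stalk x)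
  topTotal : TopologicalSpace (Σ x, stalk x)
  isLocalHomeomorph_proj : IsLocalHomeomorph (Sigma.fst : (Σ x, stalk x) → carrier)
  continuous_zero (U : Opens carrier) :
    Continuous (fun x : U => (⟨x, 0⟩ : Σ x, stalk x))
  continuous_add (U : Opens carrier) (s t : ∀ x : U, stalk x) :
    Continuous (fun x : U => (⟨x, s x⟩ : Σ x, stalk x)) →
    Continuous (fun x : U => (⟨x, t x⟩ : Σ x, stalk x)) →
    Continuous (fun x : U => (⟨x, s x + t x⟩ : Σ x, stalk x))
  continuous_compl (U : Opens carrier) (s : ∀ x : U, stalk x) :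
    Continuous (fun x : U => (⟨x, s x⟩ : Σ x, stalk x)) →
    Continuous (fun x : U => (⟨x, (s x)ᶜ⟩ : Σ x, stalk x))

attribute [instance] MVSpace.top MVSpace.algebra

namespace MVSpace

/-- The total space `E` of the étale space of an mv-space. -/
abbrev Total (X : MVSpace.{u}) : Type u := Σ x, X.stalk x

instance topologicalSpaceTotal (X : MVSpace.{u}) : TopologicalSpace X.Total := X.topTotal

/-- A family of germs over an open set `U` is a section if it is a continuous map `U → E`. -/
def IsSection (X : MVSpace.{u}) (U : Opens X.carrier) (s : ∀ x : U, X.stalk x) : Prop :=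
  Continuous (fun x : U => (⟨x, s x⟩ : X.Total))

/-- A morphism `(f, φ)` of mv-spaces. -/
structure Hom (X Y : MVSpace.{u}) : Type u where
  base : C(X.carrier, Y.carrier)
  stalkMap (x : X.carrier) : MVHom (Y.stalk (base x)) (X.stalk x)
  isSection (V : Opens Y.carrier) (s : ∀ y : V, Y.stalk y) : Y.IsSection V s →
    X.IsSection (V.comap base) (fun x => stalkMap x (s ⟨base x, x.2⟩))

instance : Category.{u} MVSpace.{u} where
  Hom := Hom
  id X :=
    { base := ContinuousMap.id _
      stalkMap := fun x => MVHom.id (X.stalk x)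
      isSection := fun _ _ h => h }
  comp {X Y Z} F G :=
    { base := G.base.comp F.base
      stalkMap := fun x => (F.stalkMap x).comp (G.stalkMap (F.base x))
      isSection := fun V s h => F.isSection _ _ (G.isSection V s h) }

theorem Hom.ext' {X Y : MVSpace.{u}} {F G : Hom X Y} (h : F.base = G.base)
    (h2 : ∀ x, F.stalkMap x ≍ G.stalkMap x) : F = G := by
  obtain ⟨f, φ, hf⟩ := F
  obtain ⟨g, ψ, hg⟩ := G
  obtain rfl : f = g := h
  obtain rfl : φ = ψ := funext fun x => eq_of_heq (h2 x)
  rfl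

/-- Global sections `X → E`. -/
def GlobalSection (X : MVSpace.{u}) : Type u :=
  {s : ∀ x, X.stalk x // Continuous (fun x => (⟨x, s x⟩ : X.Total))}

theorem isSection_top_iff (X : MVSpace.{u}) (s : ∀ x, X.stalk x) :
    X.IsSection ⊤ (fun x => s x) ↔ Continuous (fun x => (⟨x, s x⟩ : X.Total)) := by
  constructor
  · intro h
    have h2 : Continuous (fun x : X.carrier => (⟨x, trivial⟩ : (⊤ : Opens X.carrier))) := by
      fun_prop
    exact Continuous.comp h h2
  · intro h
    exact h.comp continuous_subtype_val

instance (X : MVSpace.{u}) : Zero X.GlobalSection :=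
  ⟨fun _ => 0, (X.isSection_top_iff fun _ => 0).1 (X.continuous_zero ⊤)⟩

instance (X : MVSpace.{u}) : Add X.GlobalSection :=
  ⟨fun s t => ⟨fun x => s.1 x + t.1 x, (X.isSection_top_iff fun x => s.1 x + t.1 x).1
    (X.continuous_add ⊤ _ _ ((X.isSection_top_iff s.1).2 s.2)
      ((X.isSection_top_iff t.1).2 t.2))⟩⟩

instance (X : MVSpace.{u}) : Compl X.GlobalSection :=
  ⟨fun s => ⟨fun x => (s.1 x)ᶜ, (X.isSection_top_iff fun x => (s.1 x)ᶜ).1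
    (X.continuous_compl ⊤ _ ((X.isSection_top_iff s.1).2 s.2))⟩⟩

/-- The MV-algebra of global sections, with pointwise operations. -/
instance (X : MVSpace.{u}) : MVAlgebra X.GlobalSection where
  nsmul := nsmulRec
  add_assoc _ _ _ := Subtype.ext (funext fun _ => add_assoc _ _ _)
  add_comm _ _ := Subtype.ext (funext fun _ => add_comm _ _)
  zero_add _ := Subtype.ext (funext fun _ => zero_add _)
  add_zero _ := Subtype.ext (funext fun _ => add_zero _)
  compl_compl _ := Subtype.ext (funext fun _ => MVAlgebra.compl_compl _)
  add_one _ := Subtype.ext (funext fun _ => MVAlgebra.add_one _)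
  lukasiewicz _ _ := Subtype.ext (funext fun _ => MVAlgebra.lukasiewicz _ _)

/-- Pulling back global sections along a morphism `(f, φ)`: `s ↦ (x ↦ φ_x (s (f x)))`. -/
def Hom.pullback {X Y : MVSpace.{u}} (F : Hom X Y) : MVHom Y.GlobalSection X.GlobalSection where
  toFun s := ⟨fun x => F.stalkMap x (s.1 (F.base x)),
    (X.isSection_top_iff fun x => F.stalkMap x (s.1 (F.base x))).1
      (F.isSection ⊤ (fun y => s.1 y) ((Y.isSection_top_iff s.1).2 s.2))⟩
  map_zero' := Subtype.ext (funext fun x => (F.stalkMap x).map_zero)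
  map_add' _ _ := Subtype.ext (funext fun x => (F.stalkMap x).map_add _ _)
  map_compl' _ := Subtype.ext (funext fun x => (F.stalkMap x).map_compl _)

/-- The functor `Γ` of global sections. -/
def Gamma : MVSpace.{u}ᵒᵖ ⥤ MVAlgCat.{u} where
  obj X := ⟨X.unop.GlobalSection⟩
  map F := F.unop.pullback
  map_id _ := rfl
  map_comp _ _ := rfl

end MVSpace

/-! ### The prime spectrum -/

/-- The points of the prime spectrum `Z_A`. -/
def MVSpec (A : Type u) [MVAlgebra A] : Type u := {P : MVIdeal A // P.IsPrime}

namespace MVSpec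

variable {A B : Type u} [MVAlgebra A] [MVAlgebra B]

/-- `W_a = {P | a ∈ P}` -/
def W (a : A) : Set (MVSpec A) := {P | a ∈ P.1}

/-- The coZariski topology, with open base the sets `W_a`. -/
instance : TopologicalSpace (MVSpec A) := generateFrom (Set.range W)

theorem W_inter (a b : A) : W a ∩ W b = W (a + b) :=
  Set.ext fun P => (P.1.add_mem_iff a b).symm

theorem W_zero : W (0 : A) = Set.univ := Set.eq_univ_of_forall fun P => P.1.zero_mem

theorem isTopologicalBasis_W : IsTopologicalBasis (Set.range (W : A → Set (MVSpec A))) where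
  exists_subset_inter := by
    rintro _ ⟨a, rfl⟩ _ ⟨b, rfl⟩ P hP
    exact ⟨_, ⟨a + b, rfl⟩, by rwa [← W_inter], by rw [W_inter]⟩
  sUnion_eq := Set.eq_univ_of_univ_subset fun P _ =>
    ⟨W 0, ⟨0, rfl⟩, by rw [W_zero]; trivial⟩
  eq_generateFrom := rfl

theorem isOpen_W (a : A) : IsOpen (W a) := isTopologicalBasis_W.isOpen ⟨a, rfl⟩

variable (A) in
/-- The disjoint union `E_A` of the quotients `A/P`. -/
abbrev Total : Type u := Σ P : MVSpec A, P.1.Quot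

/-- The global section `P ↦ [a]_P`. -/
def hat (a : A) (P : MVSpec A) : Total A := ⟨P, P.1.cls a⟩

theorem hat_eq_hat (a b : A) (P : MVSpec A) : hat a P = hat b P ↔ P ∈ W (distance a b) := by
  constructor
  · intro h
    exact P.1.cls_eq_cls.1 (eq_of_heq (Sigma.mk.inj h).2)
  · intro h
    exact congrArg (Sigma.mk P) (P.1.cls_eq_cls.2 h)

/-- The topology of `E_A`, with open base the images of the sets `W_b` under the sections
`P ↦ [a]_P`. -/
instance : TopologicalSpace (Total A) :=
  generateFrom (Set.range fun p : A × A => hat p.1 '' W p.2)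

theorem hat_preimage (a c d : A) : hat a ⁻¹' (hat c '' W d) = W (d + distance c a) := by
  rw [← W_inter]
  ext P
  constructor
  · rintro ⟨Q, hQ, h⟩
    obtain rfl : Q = P := congrArg Sigma.fst h
    exact ⟨hQ, (hat_eq_hat c a Q).1 h⟩
  · rintro ⟨h1, h2⟩
    exact ⟨P, h1, (hat_eq_hat c a P).2 h2⟩

theorem continuous_hat (a : A) : Continuous (hat a) := by
  refine continuous_generateFrom_iff.2 ?_
  rintro _ ⟨⟨c, d⟩, rfl⟩
  rw [hat_preimage]
  exact isOpen_W _

theorem isOpenMap_hat (a : A) : IsOpenMap (hat a) := by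
  refine isTopologicalBasis_W.isOpenMap_iff.2 ?_
  rintro _ ⟨b, rfl⟩
  exact isOpen_generateFrom_of_mem ⟨(a, b), rfl⟩

theorem exists_hat (e : Total A) : ∃ a, hat a e.1 = e := by
  obtain ⟨P, q⟩ := e
  obtain ⟨a, rfl⟩ := P.1.cls_surjective q
  exact ⟨a, rfl⟩

theorem continuous_fst : Continuous (Sigma.fst : Total A → MVSpec A) := by
  refine continuous_generateFrom_iff.2 ?_
  rintro _ ⟨a, rfl⟩
  have h : (Sigma.fst : Total A → MVSpec A) ⁻¹' W a = ⋃ c, hat c '' W a := by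
    ext e
    simp only [Set.mem_iUnion]
    constructor
    · intro he
      obtain ⟨c, hc⟩ := exists_hat e
      exact ⟨c, e.1, he, hc⟩
    · rintro ⟨c, P, hP, rfl⟩
      exact hP
  rw [h]
  exact isOpen_iUnion fun c => isOpenMap_hat c _ (isOpen_W a)

theorem isLocalHomeomorph_fst : IsLocalHomeomorph (Sigma.fst : Total A → MVSpec A) := by
  intro e
  obtain ⟨a, ha⟩ := exists_hat e
  refine ⟨{ toFun := Sigma.fst
            invFun := hat a
            source := Set.range (hat a)
            target := Set.univ
            map_source' := fun _ _ => trivial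
            map_target' := fun P _ => ⟨P, rfl⟩
            left_inv' := by rintro _ ⟨P, rfl⟩; rfl
            right_inv' := fun _ _ => rfl
            open_source := (isOpenMap_hat a).isOpen_range
            open_target := isOpen_univ
            continuousOn_toFun := continuous_fst.continuousOn
            continuousOn_invFun := (continuous_hat a).continuousOn }, ⟨e.1, ha⟩, rfl⟩

/-- A family of germs is continuous iff it is locally of the form `P ↦ [a]_P`. -/
theorem continuous_iff (U : Opens (MVSpec A)) (s : ∀ P : U, P.1.1.Quot) :
    Continuous (fun P : U => (⟨P, s P⟩ : Total A)) ↔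
      ∀ P : U, ∃ a : A, ∀ᶠ Q in nhds P, s Q = Q.1.1.cls a := by
  constructor
  · intro h P
    obtain ⟨a, ha⟩ := exists_hat (⟨P, s P⟩ : Total A)
    refine ⟨a, ?_⟩
    have h1 : Set.range (hat a) ∈ nhds (⟨P, s P⟩ : Total A) :=
      (isOpenMap_hat a).isOpen_range.mem_nhds ⟨_, ha⟩
    filter_upwards [h.continuousAt.preimage_mem_nhds h1] with Q hQ
    obtain ⟨R, hR⟩ := hQ
    obtain rfl : R = Q.1 := congrArg Sigma.fst hR
    exact (eq_of_heq (Sigma.mk.inj hR).2).symm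
  · intro h
    refine continuous_iff_continuousAt.2 fun P => ?_
    obtain ⟨a, ha⟩ := h P
    have h1 : Continuous (fun Q : U => hat a Q.1) := (continuous_hat a).comp continuous_subtype_val
    refine h1.continuousAt.congr ?_
    filter_upwards [ha] with Q hQ
    exact congrArg (Sigma.mk Q.1) hQ.symm

variable (A) in
/-- The mv-space `Spec_A = (Z_A, E_A)`. -/
def space : MVSpace.{u} where
  carrier := MVSpec A
  stalk P := P.1.Quot
  isChain P := P.2.isChain
  topTotal := inferInstanceAs (TopologicalSpace (Total A))
  isLocalHomeomorph_proj := isLocalHomeomorph_fst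
  continuous_zero U := (continuous_iff U _).2 fun _ => ⟨0, Filter.Eventually.of_forall fun _ => rfl⟩
  continuous_add U s t hs ht := by
    refine (continuous_iff U _).2 fun P => ?_
    obtain ⟨a, ha⟩ := (continuous_iff U s).1 hs P
    obtain ⟨b, hb⟩ := (continuous_iff U t).1 ht P
    refine ⟨a + b, ?_⟩
    filter_upwards [ha, hb] with Q h1 h2
    rw [h1, h2, MVIdeal.cls_add]
  continuous_compl U s hs := by
    refine (continuous_iff U _).2 fun P => ?_
    obtain ⟨a, ha⟩ := (continuous_iff U s).1 hs P
    refine ⟨aᶜ, ?_⟩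
    filter_upwards [ha] with Q h1
    rw [h1, MVIdeal.cls_compl]

/-- The continuous map `Z_B → Z_A`, `P ↦ f⁻¹(P)`, induced by `f : A → B`. -/
def comap (f : MVHom A B) : C(MVSpec B, MVSpec A) where
  toFun P := ⟨MVIdeal.comap f P.1, P.2.comap f⟩
  continuous_toFun := by
    refine continuous_generateFrom_iff.2 ?_
    rintro _ ⟨a, rfl⟩
    exact isOpen_W (f a)

/-- The morphism of mv-spaces `Spec_B → Spec_A` induced by `f : A → B`. -/
def map (f : MVHom A B) : MVSpace.Hom (space B) (space A) where
  base := comap f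
  stalkMap P := MVIdeal.quotMap f P.1
  isSection V s hs := by
    refine (continuous_iff _ _).2 fun P => ?_
    obtain ⟨a, ha⟩ := (continuous_iff V s).1 hs ⟨comap f P.1, P.2⟩
    refine ⟨f a, ?_⟩
    have h1 : Continuous (fun Q : V.comap (comap f) => (⟨comap f Q.1, Q.2⟩ : V)) :=
      ((comap f).continuous.comp continuous_subtype_val).subtype_mk _
    filter_upwards [h1.continuousAt.eventually ha] with Q hQ
    exact congrArg (MVIdeal.quotMap f Q.1.1) hQ

end MVSpec

/-- The functor `Spec` from the opposite category of MV-algebras to mv-spaces. -/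
def MVSpace.Spec : MVAlgCat.{u}ᵒᵖ ⥤ MVSpace.{u} where
  obj A := MVSpec.space A.unop.carrier
  map f := MVSpec.map f.unop
  map_id A := MVSpace.Hom.ext' rfl fun P => heq_of_eq (by ext ⟨x⟩; rfl)
  map_comp f g := MVSpace.Hom.ext' rfl fun P => heq_of_eq (by ext ⟨x⟩; rfl)

/-! ### The two categories of the duality -/

/-- The class of hyperarchimedean MV-algebras. -/
def MVAlgCat.hyperarchimedean : ObjectProperty MVAlgCat.{u} :=
  fun A => IsHyperarchimedean A.carrier

/-- The class of mv-spaces `(X, E)` that are global Hausdorff sheaves of simple MV-algebras over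
a Stone space: `X` is compact Hausdorff with a base of clopen sets, `E` is Hausdorff,
each fiber is simple, and each point of `E` is a value of a global section. -/
def MVSpace.globalHausdorffStone : ObjectProperty MVSpace.{u} := fun X =>
  (CompactSpace X.carrier ∧ T2Space X.carrier ∧
    IsTopologicalBasis {U : Set X.carrier | IsClopen U}) ∧
  T2Space X.Total ∧
  (∀ x, MVAlgebra.IsSimple (X.stalk x)) ∧
  ∀ (x : X.carrier) (e : X.stalk x), ∃ s : X.GlobalSection, s.1 x = e

/-- The restriction of `Spec` to hyperarchimedean MV-algebras, given that it takes values in the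
global Hausdorff sheaves of simple MV-algebras over Stone spaces. -/
def MVSpace.SpecRestrict
    (h : ∀ A : MVAlgCat.{u}, MVAlgCat.hyperarchimedean A →
      MVSpace.globalHausdorffStone (MVSpace.Spec.obj (op A))) :
    (MVAlgCat.hyperarchimedean.{u}.FullSubcategory)ᵒᵖ ⥤
      MVSpace.globalHausdorffStone.{u}.FullSubcategory :=
  MVSpace.globalHausdorffStone.lift (MVAlgCat.hyperarchimedean.ι.op ⋙ MVSpace.Spec)
    fun A => h A.unop.obj A.unop.property

/-- The restriction of `Γ` to global Hausdorff sheaves of simple MV-algebras over Stone spaces,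
given that it takes values in the hyperarchimedean MV-algebras. -/
def MVSpace.GammaRestrict
    (h : ∀ X : MVSpace.{u}, MVSpace.globalHausdorffStone X →
      MVAlgCat.hyperarchimedean (MVSpace.Gamma.obj (op X))) :
    (MVSpace.globalHausdorffStone.{u}.FullSubcategory)ᵒᵖ ⥤
      MVAlgCat.hyperarchimedean.{u}.FullSubcategory :=
  MVAlgCat.hyperarchimedean.lift (MVSpace.globalHausdorffStone.ι.op ⋙ MVSpace.Gamma)
    fun X => h X.unop.obj X.unop.property

end

/-! Idempotents drive both directions. In a hyperarchimedean algebra each `a` has an idempotent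
multiple `n • a`, and it lies in the same ideals as `a`. A prime ideal contains exactly one of an
idempotent and its complement, so the complement of `W a` is again basic open. Hence the spectrum,
compact for every MV-algebra, becomes a Stone space and `E_A` becomes Hausdorff. Each fiber is a
hyperarchimedean chain, whose only idempotents are `0` and `1`, hence simple.

The map `A → Γ(Spec A)` is injective because a nonzero element is avoided by a maximal, hence prime,
ideal. It is surjective because a section is locally the class of an element, and by compactness
idempotents glue finitely many local representatives into one (`exists_glue`).

Conversely, send a point `x` of `X` to the ideal of global sections vanishing at `x`. Clopen sets
give sections with values `0` and `1`, so this map is injective. Compactness and simplicity of the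
stalks give every proper ideal a common zero, and a prime ideal of a hyperarchimedean algebra is
maximal, so the map is onto. A continuous bijection from a compact space to a Hausdorff one is a
homeomorphism. Since global sections reach every point of `E`, the stalk at `x` is the quotient of
`Γ(X)` by this ideal. Naturality on points uses that morphisms out of simple stalks are injective.
-/

namespace MVAlgebra

variable {A : Type u} [MVAlgebra A]

/-! ### Order and arithmetic of MV-algebras -/

theorem le_refl (x : A) : Le x x := ⟨0, add_zero x⟩

theorem le_antisymm {x y : A} (h : Le x y) (h2 : Le y x) : x = y := by
  have e := lukasiewicz x y
  rw [(le_iff x y).1 h, (le_iff y x).1 h2, compl_compl, zero_add, zero_add] at e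
  exact e.symm

theorem zero_le (x : A) : Le 0 x := ⟨x, zero_add x⟩

theorem eq_zero_of_le_zero {x : A} (h : Le x 0) : x = 0 := le_antisymm h (zero_le x)

theorem le_add_right (x y : A) : Le x (x + y) := ⟨y, rfl⟩

theorem le_add_left (x y : A) : Le x (y + x) := ⟨y, add_comm x y⟩

theorem le_one (x : A) : Le x 0ᶜ := (le_iff _ _).2 (add_one _)

theorem one_le_iff {x : A} : Le 0ᶜ x ↔ x = 0ᶜ :=
  ⟨fun h => le_antisymm (le_one x) h, fun h => h ▸ le_refl _⟩

theorem distance_eq_zero {x y : A} : distance x y = 0 ↔ x = y := by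
  refine ⟨fun h => ?_, fun h => h ▸ distance_self x⟩
  refine le_antisymm ((le_iff_ominus x y).2 ?_) ((le_iff_ominus y x).2 ?_)
  · exact eq_zero_of_le_zero (h ▸ le_add_right _ _)
  · exact eq_zero_of_le_zero (h ▸ le_add_left _ _)

theorem compl_odot (x y : A) : (odot x y)ᶜ = xᶜ + yᶜ := compl_compl _

theorem compl_add (x y : A) : (x + y)ᶜ = odot xᶜ yᶜ := by rw [odot, compl_compl, compl_compl]

theorem odot_comm (x y : A) : odot x y = odot y x := by rw [odot, odot, add_comm]

theorem odot_assoc (x y z : A) : odot (odot x y) z = odot x (odot y z) := by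
  simp only [odot, compl_compl, add_assoc]

theorem odot_one (x : A) : odot x 0ᶜ = x := by rw [odot, compl_compl, add_zero, compl_compl]

theorem odot_zero (x : A) : odot x 0 = 0 := by rw [odot, add_one, compl_compl]

theorem odot_compl_self (x : A) : odot x xᶜ = 0 := by
  rw [odot, add_comm, compl_add_self, compl_compl]

/-- Commutativity of the infimum `x ⊙ (¬x ⊕ y)`. -/
theorem odot_compl_add (x y : A) : odot x (xᶜ + y) = odot y (yᶜ + x) := by
  have h := lukasiewicz xᶜ yᶜ
  simp only [compl_compl] at h
  rw [odot, odot, add_comm xᶜ, add_comm yᶜ, add_comm xᶜ y, add_comm yᶜ x, add_comm y, h, add_comm y]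

/-- The infimum of `x ⊖ y` and `y ⊖ x` is `0`. -/
theorem odot_ominus_ominus (x y : A) :
    odot (odot x yᶜ) ((odot x yᶜ)ᶜ + odot y xᶜ) = 0 := by
  set v := odot y xᶜ with hv
  set w := (xᶜ + v)ᶜ with hw
  have e1 : odot yᶜ (y + (xᶜ + v)) = odot (xᶜ + v) (w + yᶜ) := by
    have := odot_compl_add yᶜ (xᶜ + v)
    rwa [compl_compl] at this
  -- The infimum of `a` and `b` is `a ⊙ (¬a ⊕ b)`. Commuting such an infimum three times rearranges
  -- the product until `x` and `¬x` both occur as factors.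
  calc odot (odot x yᶜ) ((odot x yᶜ)ᶜ + v)
      = odot x (odot yᶜ (y + (xᶜ + v))) := by
        rw [odot_assoc, compl_odot, compl_compl, add_comm xᶜ y, add_assoc]
    _ = odot (odot x (xᶜ + v)) (w + yᶜ) := by rw [e1, odot_assoc]
    _ = odot (odot v (vᶜ + x)) (w + yᶜ) := by rw [odot_compl_add]
    _ = odot (odot xᶜ (vᶜ + x)) (odot y (yᶜ + w)) := by
        rw [add_comm w, hv, odot_comm y xᶜ, odot_assoc xᶜ, odot_assoc xᶜ, odot_assoc xᶜ,
          odot_comm y, odot_assoc, odot_comm y]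
    _ = odot (odot xᶜ (vᶜ + x)) (odot w (wᶜ + y)) := by rw [odot_compl_add y w]
    _ = 0 := by
        have e2 : w = odot x vᶜ := by rw [hw, compl_add, compl_compl]
        rw [odot_comm w, ← odot_assoc, odot_comm, e2, odot_assoc, odot_comm vᶜ, odot_assoc xᶜ,
          odot_assoc xᶜ, ← odot_assoc x, odot_compl_self, odot_comm, odot_zero]

theorem ominus_add (x y z : A) : ominus x (y + z) = ominus (ominus x y) z := by
  simp only [ominus_eq, compl_compl, add_assoc]

theorem ominus_le (x y : A) : Le (ominus x y) x := (ominus_le_iff x x y).2 (le_add_right _ _)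

theorem ominus_one (x : A) : ominus x 0ᶜ = 0 := (le_iff_ominus _ _).1 (le_one x)

/-- In general `a ⊖ (a ⊖ b)` is the infimum of `a` and `b`; when that is `0`, subtracting `b` leaves
`a` unchanged. -/
theorem ominus_ominus_comm (x y : A) :
    ominus (ominus y x) (ominus x y) = ominus y x := by
  refine le_antisymm (ominus_le _ _) ((le_iff_ominus _ _).2 ?_)
  have h := odot_ominus_ominus y x
  rw [ominus_eq, ominus_eq (ominus y x) (ominus x y), ← odot_ominus_ominus y x]
  simp only [ominus, odot, compl_compl]

/-- The disjointness of the two differences persists for multiples, which is what makes maximal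
ideals prime. -/
theorem ominus_nsmul_ominus (x y : A) (n : ℕ) :
    ominus (ominus y x) (n • ominus x y) = ominus y x := by
  induction n with
  | zero => rw [zero_nsmul, ominus_eq, add_zero, compl_compl]
  | succ n ih => rw [succ_nsmul, ominus_add, ih, ominus_ominus_comm]

/-! ### Idempotent elements -/

/-- The Łukasiewicz axiom for `b` and `¬b` turns `b ⊕ b = b` into `¬b ⊕ ¬b ≤ ¬b`. -/
theorem compl_add_compl_of_idem {b : A} (hb : b + b = b) : bᶜ + bᶜ = bᶜ := by
  refine le_antisymm ((le_iff _ _).2 ?_) (le_add_right _ _)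
  have h := lukasiewicz b bᶜ
  rw [compl_compl, hb, compl_add_self] at h
  exact h

theorem nsmul_of_idem {b : A} (hb : b + b = b) (n : ℕ) : Le (n • b) b := by
  induction n with
  | zero => rw [zero_nsmul]; exact zero_le b
  | succ n ih =>
    have := add_le_add ih (le_refl b)
    rwa [hb, ← succ_nsmul] at this

theorem nsmul_add_nsmul_of_eq {a : A} {n : ℕ} (h : n • a = (n + 1) • a) (k : ℕ) :
    n • a + k • a = n • a := by
  induction k with
  | zero => rw [zero_nsmul, add_zero]
  | succ k ih => rw [succ_nsmul, ← add_assoc, ih, ← succ_nsmul, ← h]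

/-- Lets finitely many stabilization exponents be replaced by one common exponent. -/
theorem nsmul_eq_of_le {a : A} {n m : ℕ} (h : n • a = (n + 1) • a) (hm : n ≤ m) :
    m • a = (m + 1) • a := by
  obtain ⟨k, rfl⟩ := Nat.exists_eq_add_of_le hm
  rw [add_assoc, add_nsmul, add_nsmul, nsmul_add_nsmul_of_eq h, nsmul_add_nsmul_of_eq h]

theorem le_nsmul {a : A} {n : ℕ} (hn : 1 ≤ n) : Le a (n • a) := by
  obtain ⟨k, rfl⟩ := Nat.exists_eq_add_of_le hn
  rw [add_nsmul, one_nsmul]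
  exact le_add_right _ _

/-- Compare `b` with `¬b`: if `b ≤ ¬b` then `1 = ¬b ⊕ ¬b = ¬b`, and dually. -/
theorem IsChain.eq_zero_or_eq_one_of_idem (hA : IsChain A) {b : A} (hb : b + b = b) :
    b = 0 ∨ b = 0ᶜ := by
  rcases hA.2 b bᶜ with h | h
  · left
    rw [le_iff, compl_add_compl_of_idem hb] at h
    rw [← compl_compl b, h, compl_compl]
  · right
    rwa [le_iff, compl_compl, hb] at h

end MVAlgebra

open MVAlgebra

/-! ### Bijective morphisms -/

namespace MVHom

variable {A B : Type u} [MVAlgebra A] [MVAlgebra B]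

theorem map_nsmul (f : MVHom A B) (n : ℕ) (x : A) : f (n • x) = n • f x :=
  _root_.map_nsmul f.toAddMonoidHom n x

/-- The inverse of a bijective morphism. -/
noncomputable def symmOfBijective (f : MVHom A B) (hf : Function.Bijective f) : MVHom B A where
  toFun := (Equiv.ofBijective f hf).symm
  map_zero' := by
    rw [Equiv.symm_apply_eq]
    exact f.map_zero.symm
  map_add' x y := by
    rw [Equiv.symm_apply_eq]
    refine Eq.trans ?_ (f.map_add _ _).symm
    congr 1
    · exact ((Equiv.ofBijective f hf).apply_symm_apply x).symm
    · exact ((Equiv.ofBijective f hf).apply_symm_apply y).symm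
  map_compl' x := by
    refine (Equiv.symm_apply_eq _).2 ?_
    refine Eq.trans ?_ (f.map_compl _).symm
    congr 1
    exact ((Equiv.ofBijective f hf).apply_symm_apply x).symm

theorem apply_symmOfBijective (f : MVHom A B) (hf : Function.Bijective f) (y : B) :
    f (f.symmOfBijective hf y) = y :=
  (Equiv.ofBijective f hf).apply_symm_apply y

theorem symmOfBijective_apply (f : MVHom A B) (hf : Function.Bijective f) (x : A) :
    f.symmOfBijective hf (f x) = x :=
  (Equiv.ofBijective f hf).symm_apply_apply x

end MVHom

/-! ### Generated, maximal and prime ideals -/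

namespace MVIdeal

variable {A : Type u} [MVAlgebra A]

/-- The quotient morphism `A → A/I`. -/
def clsHom (I : MVIdeal A) : MVHom A I.Quot where
  toFun := I.cls
  map_zero' := rfl
  map_add' _ _ := rfl
  map_compl' _ := rfl

theorem cls_nsmul (I : MVIdeal A) (n : ℕ) (x : A) : I.cls (n • x) = n • I.cls x :=
  I.clsHom.map_nsmul n x

@[ext] theorem ext {I J : MVIdeal A} (h : ∀ x, x ∈ I ↔ x ∈ J) : I = J := by
  obtain ⟨I, _, _, _⟩ := I
  obtain ⟨J, _, _, _⟩ := J
  obtain rfl : I = J := Set.ext h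
  rfl

theorem nsmul_mem (I : MVIdeal A) {x : A} (hx : x ∈ I) (n : ℕ) : n • x ∈ I := by
  induction n with
  | zero => rw [zero_nsmul]; exact I.zero_mem
  | succ n ih => rw [succ_nsmul]; exact I.add_mem ih hx

theorem nsmul_mem_iff (I : MVIdeal A) {x : A} {n : ℕ} (hn : 1 ≤ n) : n • x ∈ I ↔ x ∈ I :=
  ⟨fun h => I.lower h (le_nsmul hn), fun h => I.nsmul_mem h n⟩

/-- The ideal `{0}`. -/
def zeroIdeal (A : Type u) [MVAlgebra A] : MVIdeal A where
  carrier := {0}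
  zero_mem := rfl
  lower := by
    rintro x y rfl h
    exact eq_zero_of_le_zero h
  add_mem := by
    rintro x y rfl rfl
    exact add_zero 0

/-- The ideal generated by an ideal and an element. -/
def adjoin (I : MVIdeal A) (x : A) : MVIdeal A where
  carrier := {y | ∃ p ∈ I, ∃ n : ℕ, Le y (p + n • x)}
  zero_mem := ⟨0, I.zero_mem, 0, zero_le _⟩
  lower := by
    rintro y z ⟨p, hp, n, h⟩ hz
    exact ⟨p, hp, n, MVAlgebra.le_trans hz h⟩
  add_mem := by
    rintro y z ⟨p, hp, n, h⟩ ⟨q, hq, m, h2⟩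
    refine ⟨p + q, I.add_mem hp hq, n + m, ?_⟩
    rw [add_nsmul, add_add_add_comm]
    exact MVAlgebra.add_le_add h h2

theorem le_adjoin (I : MVIdeal A) (x : A) {y : A} (hy : y ∈ I) : y ∈ I.adjoin x :=
  ⟨y, hy, 0, le_add_right _ _⟩

theorem mem_adjoin_self (I : MVIdeal A) (x : A) : x ∈ I.adjoin x :=
  ⟨0, I.zero_mem, 1, by rw [one_nsmul, zero_add]; exact le_refl x⟩

/-- For idempotent `b` one has `b ⊖ ¬b = b` and `¬b ⊖ b = ¬b`, so primality applies to this pair. -/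
theorem IsPrime.mem_or_compl_mem {P : MVIdeal A} (hP : P.IsPrime) {b : A} (hb : b + b = b) :
    b ∈ P ∨ bᶜ ∈ P := by
  rcases hP.2 b bᶜ with h | h
  · left
    rwa [ominus_eq, compl_add_compl_of_idem hb, MVAlgebra.compl_compl] at h
  · right
    rwa [ominus_eq, MVAlgebra.compl_compl, hb] at h

theorem compl_notMem {P : MVIdeal A} (hP : (0 : A)ᶜ ∉ P) {b : A} (hb : b ∈ P) : bᶜ ∉ P := by
  intro h
  have := P.add_mem h hb
  rw [compl_add_self] at this
  exact hP this

theorem exists_isMax (I : MVIdeal A) (hI : (0 : A)ᶜ ∉ I) :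
    ∃ M : MVIdeal A, (∀ x ∈ I, x ∈ M) ∧ (0 : A)ᶜ ∉ M ∧
      ∀ J : MVIdeal A, (∀ x ∈ M, x ∈ J) → (0 : A)ᶜ ∉ J → ∀ x ∈ J, x ∈ M := by
  obtain ⟨m, hIm, hm⟩ := zorn_subset_nonempty
    {s : Set A | ∃ J : MVIdeal A, J.carrier = s ∧ (0 : A)ᶜ ∉ J} (fun c hc hchain hne => by
      have key : ∀ s ∈ c, ∀ t ∈ c, ∃ r ∈ c, s ⊆ r ∧ t ⊆ r := fun s hs t ht => by
        rcases hchain.total hs ht with h | h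
        · exact ⟨t, ht, h, subset_rfl⟩
        · exact ⟨s, hs, subset_rfl, h⟩
      refine ⟨⋃₀ c, ⟨⟨⋃₀ c, ?_, ?_, ?_⟩, rfl, ?_⟩, fun s hs => Set.subset_sUnion_of_mem hs⟩
      · obtain ⟨s, hs⟩ := hne
        obtain ⟨J, rfl, -⟩ := hc hs
        exact ⟨_, hs, J.zero_mem⟩
      · rintro x y ⟨s, hs, hx⟩ h
        obtain ⟨J, rfl, -⟩ := hc hs
        exact ⟨_, hs, J.lower hx h⟩
      · rintro x y ⟨s, hs, hx⟩ ⟨t, ht, hy⟩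
        obtain ⟨r, hr, h1, h2⟩ := key s hs t ht
        obtain ⟨J, rfl, -⟩ := hc hr
        exact ⟨_, hr, J.add_mem (h1 hx) (h2 hy)⟩
      · rintro ⟨s, hs, hx⟩
        obtain ⟨J, rfl, hJ⟩ := hc hs
        exact hJ hx) I.carrier ⟨I, rfl, hI⟩
  obtain ⟨⟨M, rfl, hM⟩, hmax⟩ := hm
  exact ⟨M, fun x hx => hIm hx, hM, fun J hJ hJ1 x hx => hmax ⟨J, rfl, hJ1⟩ hJ hx⟩

/-- A maximal ideal is prime. -/
theorem isPrime_of_isMax {M : MVIdeal A} (hM : (0 : A)ᶜ ∉ M)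
    (hmax : ∀ J : MVIdeal A, (∀ x ∈ M, x ∈ J) → (0 : A)ᶜ ∉ J → ∀ x ∈ J, x ∈ M) : M.IsPrime := by
  refine ⟨hM, fun x y => or_iff_not_imp_left.2 fun hx => ?_⟩
  -- If `x ⊖ y` is outside `M`, adjoining it gives the whole algebra, so `1 = p ⊕ n(x ⊖ y)` with `p
  -- ∈ M`.
  have h1 : (0 : A)ᶜ ∈ M.adjoin (ominus x y) := by
    by_contra h
    exact hx (hmax _ (fun z hz => M.le_adjoin _ hz) h _ (M.mem_adjoin_self _))
  obtain ⟨p, hp, n, h⟩ := h1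
  rw [one_le_iff, add_comm] at h
  -- Then `(y ⊖ x) ⊖ p = (y ⊖ x) ⊖ (n(x ⊖ y) ⊕ p) = (y ⊖ x) ⊖ 1 = 0`, so `y ⊖ x ≤ p`.
  have h2 := ominus_nsmul_ominus x y n
  refine M.lower hp ((le_iff_ominus _ _).2 ?_)
  rw [← h2, ← ominus_add, h, ominus_one]

end MVIdeal

/-! ### Simple and hyperarchimedean algebras -/

namespace MVAlgebra

variable {A : Type u} [MVAlgebra A]

/-- The ideal generated by `a` consists of the elements below multiples of `a`, and simplicity
forces it to contain `1`. -/
theorem IsSimple.exists_nsmul_eq_one (hA : IsSimple A) {a : A} (ha : a ≠ 0) :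
    ∃ n : ℕ, 1 ≤ n ∧ n • a = 0ᶜ := by
  have h : (0 : A)ᶜ ∈ (MVIdeal.zeroIdeal A).adjoin a := by
    by_contra h
    exact ha (hA.2 _ h a (MVIdeal.mem_adjoin_self _ a))
  obtain ⟨p, rfl, n, h⟩ := h
  rw [one_le_iff, zero_add] at h
  refine ⟨n, Nat.one_le_iff_ne_zero.2 ?_, h⟩
  rintro rfl
  rw [zero_nsmul] at h
  exact hA.1 h.symm

theorem IsSimple.isHyperarchimedean (hA : IsSimple A) : IsHyperarchimedean A := by
  intro a
  by_cases ha : a = 0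
  · exact ⟨1, le_rfl, by rw [ha, nsmul_zero, nsmul_zero]⟩
  · obtain ⟨n, hn, h⟩ := hA.exists_nsmul_eq_one ha
    exact ⟨n, hn, by rw [succ_nsmul, h, add_comm, add_one]⟩

theorem IsHyperarchimedean.exists_idem (hA : IsHyperarchimedean A) (a : A) :
    ∃ n : ℕ, 1 ≤ n ∧ n • a + n • a = n • a := by
  obtain ⟨n, hn, h⟩ := hA a
  exact ⟨n, hn, nsmul_add_nsmul_of_eq h n⟩

theorem IsHyperarchimedean.quot (hA : IsHyperarchimedean A) (I : MVIdeal A) :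
    IsHyperarchimedean I.Quot := by
  intro q
  obtain ⟨a, rfl⟩ := I.cls_surjective q
  obtain ⟨n, hn, h⟩ := hA a
  exact ⟨n, hn, by rw [← MVIdeal.cls_nsmul, ← MVIdeal.cls_nsmul, h]⟩

/-- The idempotent multiple of `x` is `0` or `1`; in the second case any ideal containing `x` is
improper. -/
theorem IsChain.isSimple (hA : IsChain A) (h : IsHyperarchimedean A) : IsSimple A := by
  refine ⟨hA.1, fun I hI x hx => ?_⟩
  obtain ⟨n, hn, hb⟩ := h.exists_idem x
  rcases hA.eq_zero_or_eq_one_of_idem hb with h0 | h1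
  · exact eq_zero_of_le_zero (h0 ▸ le_nsmul hn)
  · exact absurd (h1 ▸ I.nsmul_mem hx n) hI

/-- In a hyperarchimedean algebra every nonzero element is avoided by a prime ideal. -/
theorem IsHyperarchimedean.exists_isPrime (hA : IsHyperarchimedean A) {a : A} (ha : a ≠ 0) :
    ∃ P : MVIdeal A, P.IsPrime ∧ a ∉ P := by
  obtain ⟨n, hn, hb⟩ := hA.exists_idem a
  -- The complement of the idempotent `n • a` generates a proper ideal, since otherwise it would be
  -- `1` and `a` would be `0`. A maximal ideal above it cannot contain `a`.
  have h1 : (0 : A)ᶜ ∉ (MVIdeal.zeroIdeal A).adjoin (n • a)ᶜ := by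
    rintro ⟨p, rfl, m, h⟩
    rw [zero_add] at h
    have h2 := le_trans h (nsmul_of_idem (compl_add_compl_of_idem hb) m)
    rw [one_le_iff] at h2
    have h3 : n • a = 0 := by rw [← compl_compl (n • a), h2, compl_compl]
    exact ha (eq_zero_of_le_zero (h3 ▸ le_nsmul hn))
  obtain ⟨M, hIM, hM, hmax⟩ := MVIdeal.exists_isMax _ h1
  refine ⟨M, MVIdeal.isPrime_of_isMax hM hmax, fun h => ?_⟩
  exact MVIdeal.compl_notMem hM (M.nsmul_mem h n) (hIM _ (MVIdeal.mem_adjoin_self _ _))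

end MVAlgebra

open MVAlgebra

/-! ### The spectrum of a hyperarchimedean algebra and its global sections -/

namespace MVSpec

variable {A B : Type u} [MVAlgebra A] [MVAlgebra B]

/-- With `n • a` idempotent, the primes that omit `a` are those that contain `¬(n • a)`. -/
theorem isClopen_W (hA : IsHyperarchimedean A) (a : A) : IsClopen (W a) := by
  refine ⟨⟨?_⟩, isOpen_W a⟩
  obtain ⟨n, hn, hb⟩ := hA.exists_idem a
  have h : (W a)ᶜ = W (n • a)ᶜ := by
    ext P
    refine ⟨fun h => ?_, fun h h2 => MVIdeal.compl_notMem P.2.1 (P.1.nsmul_mem h2 n) h⟩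
    exact (P.2.mem_or_compl_mem hb).resolve_left fun h2 => h ((P.1.nsmul_mem_iff hn).1 h2)
  rw [h]
  exact isOpen_W _

/-- An ultrafilter `F` converges to the ideal `{a | W a ∈ F}`. It is prime because `W (x ⊖ y)` and
`W (y ⊖ x)` cover the spectrum, so one of them is in `F`. -/
instance : CompactSpace (MVSpec A) := by
  refine ⟨isCompact_iff_ultrafilter_le_nhds.2 fun F _ => ?_⟩
  let I : MVIdeal A :=
    { carrier := {a | W a ∈ F}
      zero_mem := by
        change W (0 : A) ∈ F
        rw [W_zero]
        exact Filter.univ_mem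
      lower := fun {x y} hx h => Filter.mem_of_superset hx fun P hP => P.1.lower hP h
      add_mem := fun {x y} hx hy => by
        change W (x + y) ∈ F
        rw [← W_inter]
        exact Filter.inter_mem hx hy }
  have hI : I.IsPrime := by
    refine ⟨fun h => ?_, fun x y => ?_⟩
    · obtain ⟨P, hP⟩ := F.nonempty_of_mem h
      exact P.2.1 hP
    · exact Ultrafilter.union_mem_iff.1 (Filter.mem_of_superset Filter.univ_mem fun P _ => P.2.2 x y)
  refine ⟨⟨I, hI⟩, trivial, ?_⟩
  refine (isTopologicalBasis_W.nhds_hasBasis.ge_iff).2 ?_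
  rintro _ ⟨⟨a, rfl⟩, h⟩
  exact h

theorem t2Space (hA : IsHyperarchimedean A) : T2Space (MVSpec A) := by
  refine ⟨fun P Q hPQ => ?_⟩
  have h : ∃ a, ¬(a ∈ P.1 ↔ a ∈ Q.1) := by
    by_contra! h
    exact hPQ (Subtype.ext (MVIdeal.ext h))
  obtain ⟨a, ha⟩ := h
  have h1 := isClopen_W hA a
  by_cases hP : a ∈ P.1
  · exact ⟨W a, (W a)ᶜ, h1.2, h1.compl.2, hP, fun hQ => ha ⟨fun _ => hQ, fun _ => hP⟩,
      disjoint_compl_right⟩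
  · refine ⟨(W a)ᶜ, W a, h1.compl.2, h1.2, hP, ?_, disjoint_compl_left⟩
    by_contra hQ
    exact ha ⟨fun h => absurd h hP, fun h => absurd h hQ⟩

/-- Two points of one fiber are values of sections `hat a` and `hat b`, which agree exactly on the
clopen set `W (distance a b)`; their images over its complement are disjoint. -/
theorem t2Space_total (hA : IsHyperarchimedean A) : T2Space (Total A) := by
  refine ⟨fun e e' hne => ?_⟩
  by_cases h : e.1 = e'.1
  · obtain ⟨a, ha⟩ := exists_hat e
    obtain ⟨b, hb⟩ := exists_hat e'
    have h1 := isClopen_W hA (distance a b)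
    refine ⟨hat a '' (W (distance a b))ᶜ, hat b '' (W (distance a b))ᶜ,
      isOpenMap_hat a _ h1.compl.2, isOpenMap_hat b _ h1.compl.2, ⟨e.1, fun hP => hne ?_, ha⟩,
      ⟨e'.1, fun hP => hne ?_, hb⟩, ?_⟩
    · rw [← ha, (hat_eq_hat a b e.1).2 hP, h, hb]
    · rw [← hb, ← (hat_eq_hat a b e'.1).2 hP, ← h, ha]
    · rw [Set.disjoint_left]
      rintro _ ⟨P, hP, rfl⟩ ⟨Q, hQ, hPQ⟩
      obtain rfl : Q = P := congrArg Sigma.fst hPQ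
      exact hP ((hat_eq_hat a b Q).1 hPQ.symm)
  · have := t2Space hA
    obtain ⟨U, V, hU, hV, h1, h2, h3⟩ := t2_separation h
    exact ⟨_, _, hU.preimage continuous_fst, hV.preimage continuous_fst, h1, h2,
      h3.preimage _⟩

variable (A) in
/-- The morphism `A → Γ(Spec A)`, `a ↦ (P ↦ [a]_P)`. -/
def toSections : MVHom A (space A).GlobalSection where
  toFun a := ⟨fun P => P.1.cls a, continuous_hat a⟩
  map_zero' := rfl
  map_add' _ _ := rfl
  map_compl' _ := rfl

theorem globalHausdorffStone_space (hA : IsHyperarchimedean A) :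
    MVSpace.globalHausdorffStone (space A) := by
  refine ⟨⟨inferInstanceAs (CompactSpace (MVSpec A)), t2Space hA, ?_⟩, t2Space_total hA,
    fun P => P.2.isChain.isSimple (hA.quot P.1), fun P e => ?_⟩
  · refine isTopologicalBasis_of_isOpen_of_nhds (fun U hU => hU.2) fun P U hP hU => ?_
    obtain ⟨_, ⟨a, rfl⟩, h1, h2⟩ := isTopologicalBasis_W.exists_subset_of_mem_open hP hU
    exact ⟨W a, isClopen_W hA a, h1, h2⟩
  · obtain ⟨a, rfl⟩ := P.1.cls_surjective e
    exact ⟨toSections A a, rfl⟩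

theorem toSections_injective (hA : IsHyperarchimedean A) :
    Function.Injective (toSections A) := by
  intro a b h
  by_contra hab
  obtain ⟨P, hP, h1⟩ := hA.exists_isPrime (mt distance_eq_zero.1 hab)
  exact h1 (P.cls_eq_cls.1 (congrFun (congrArg Subtype.val h) ⟨P, hP⟩))

/-- Sections that agree with elements of the algebra on two basic open sets agree with one on
their union. -/
theorem exists_glue (hA : IsHyperarchimedean A) (s : ∀ P : MVSpec A, P.1.Quot) {b c x y : A}
    (hx : ∀ P ∈ W b, s P = P.1.cls x) (hy : ∀ P ∈ W c, s P = P.1.cls y) :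
    ∃ d z : A, W b ∪ W c ⊆ W d ∧ ∀ P ∈ W d, s P = P.1.cls z := by
  obtain ⟨n, hn, hb⟩ := hA.exists_idem b
  obtain ⟨m, hm, hc⟩ := hA.exists_idem c
  have cls_odot : ∀ (P : MVSpec A) (u v : A), P.1.cls (odot u v) = odot (P.1.cls u) (P.1.cls v) :=
    fun _ _ _ => rfl
  have hbP : ∀ P : MVSpec A, P ∉ W b → P.1.cls (n • b) = 0ᶜ := fun P hP => by
    rw [← MVAlgebra.compl_compl (n • b), MVIdeal.cls_compl, P.1.cls_eq_zero.2
      ((P.2.mem_or_compl_mem hb).resolve_left fun h => hP ((P.1.nsmul_mem_iff hn).1 h))]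
  have hcP : ∀ P : MVSpec A, P ∉ W c → P.1.cls (m • c) = 0ᶜ := fun P hP => by
    rw [← MVAlgebra.compl_compl (m • c), MVIdeal.cls_compl, P.1.cls_eq_zero.2
      ((P.2.mem_or_compl_mem hc).resolve_left fun h => hP ((P.1.nsmul_mem_iff hm).1 h))]
  -- Modulo a prime, `n • b` is `0` on `W b` and `1` off it, and likewise `m • c` for `W c`. So the
  -- first witness vanishes exactly on the union, and the second equals `x` on `W b` and `y`
  -- elsewhere.
  refine ⟨odot (n • b) (m • c), odot x (n • b)ᶜ + odot y (n • b), ?_, fun P hP => ?_⟩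
  · rintro P (hP | hP)
    · refine P.1.cls_eq_zero.1 ?_
      rw [cls_odot, P.1.cls_eq_zero.2 (P.1.nsmul_mem hP n), odot_comm, odot_zero]
    · refine P.1.cls_eq_zero.1 ?_
      rw [cls_odot, P.1.cls_eq_zero.2 (P.1.nsmul_mem hP m), odot_zero]
  · rw [MVIdeal.cls_add, cls_odot, cls_odot, MVIdeal.cls_compl]
    by_cases hPb : P ∈ W b
    · rw [P.1.cls_eq_zero.2 (P.1.nsmul_mem hPb n), odot_one, odot_zero, add_zero, hx P hPb]
    · have hPc : P ∈ W c := by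
        by_contra hPc
        have h := P.1.cls_eq_zero.2 hP
        rw [cls_odot, hbP P hPb, hcP P hPc, odot_one] at h
        exact P.2.isChain.1 h
      rw [hbP P hPb, MVAlgebra.compl_compl, odot_zero, odot_one, zero_add, hy P hPc]

theorem toSections_surjective (hA : IsHyperarchimedean A) :
    Function.Surjective (toSections A) := by
  rintro ⟨s, hs⟩
  have hloc : ∀ P : MVSpec A, ∃ a : A, ∀ᶠ Q in nhds P, s Q = Q.1.cls a := fun P => by
    obtain ⟨a, ha⟩ := exists_hat (⟨P, s P⟩ : Total A)
    refine ⟨a, ?_⟩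
    have h1 : Set.range (hat a) ∈ nhds (⟨P, s P⟩ : Total A) :=
      (isOpenMap_hat a).isOpen_range.mem_nhds ⟨_, ha⟩
    filter_upwards [hs.continuousAt.preimage_mem_nhds h1] with Q hQ
    obtain ⟨R, hR⟩ := hQ
    obtain rfl : R = Q := congrArg Sigma.fst hR
    exact (eq_of_heq (Sigma.mk.inj hR).2).symm
  have key : ∃ b a : A, Set.univ ⊆ W b ∧ ∀ P ∈ W b, s P = P.1.cls a := by
    refine (isCompact_univ (X := MVSpec A)).induction_on
      (p := fun S => ∃ b a : A, S ⊆ W b ∧ ∀ P ∈ W b, s P = P.1.cls a) ?_ ?_ ?_ ?_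
    -- `W 1` is empty because prime ideals are proper.
    · exact ⟨0ᶜ, 0, Set.empty_subset _, fun P hP => absurd hP P.2.1⟩
    · rintro S T hST ⟨b, a, h1, h2⟩
      exact ⟨b, a, hST.trans h1, h2⟩
    · rintro S T ⟨b, x, h1, hx⟩ ⟨c, y, h2, hy⟩
      obtain ⟨d, z, h3, hz⟩ := exists_glue hA s hx hy
      exact ⟨d, z, (Set.union_subset_union h1 h2).trans h3, hz⟩
    · intro P _
      obtain ⟨a, ha⟩ := hloc P
      obtain ⟨_, ⟨b, rfl⟩, h1, h2⟩ := isTopologicalBasis_W.mem_nhds_iff.1 ha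
      exact ⟨W b, mem_nhdsWithin_of_mem_nhds ((isOpen_W b).mem_nhds h1), b, a, subset_rfl,
        fun Q hQ => h2 hQ⟩
  obtain ⟨b, a, h1, h2⟩ := key
  exact ⟨a, Subtype.ext (funext fun P => (h2 P (h1 trivial)).symm)⟩

theorem toSections_bijective (hA : IsHyperarchimedean A) : Function.Bijective (toSections A) :=
  ⟨toSections_injective hA, toSections_surjective hA⟩

end MVSpec

open MVAlgebra

/-! ### Morphisms to and from quotients -/

namespace MVHom

variable {A B : Type u} [MVAlgebra A] [MVAlgebra B]

theorem cls_eq_cls_of_apply_eq (e : MVHom A B) (I : MVIdeal A) (h : ∀ a, e a = 0 → a ∈ I)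
    {a b : A} (hab : e a = e b) : I.cls a = I.cls b :=
  I.cls_eq_cls.2 (h _ (by rw [e.map_distance, hab, distance_self]))

/-- The morphism `B → A/I` induced by a surjective morphism `A → B` whose kernel is contained
in `I`. -/
noncomputable def descend (e : MVHom A B) (he : Function.Surjective e) (I : MVIdeal A)
    (h : ∀ a, e a = 0 → a ∈ I) : MVHom B I.Quot where
  toFun b := I.cls (Function.surjInv he b)
  map_zero' := e.cls_eq_cls_of_apply_eq I h (by rw [Function.surjInv_eq he, e.map_zero])
  map_add' x y := e.cls_eq_cls_of_apply_eq (b := Function.surjInv he x + Function.surjInv he y) I h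
    (by rw [e.map_add, Function.surjInv_eq he, Function.surjInv_eq he, Function.surjInv_eq he])
  map_compl' x := e.cls_eq_cls_of_apply_eq (b := (Function.surjInv he x)ᶜ) I h
    (by rw [e.map_compl, Function.surjInv_eq he, Function.surjInv_eq he])

theorem descend_apply (e : MVHom A B) (he : Function.Surjective e) (I : MVIdeal A)
    (h : ∀ a, e a = 0 → a ∈ I) (a : A) : e.descend he I h (e a) = I.cls a :=
  e.cls_eq_cls_of_apply_eq I h (Function.surjInv_eq he (e a))

/-- The morphism `A/I → B` induced by a morphism `A → B` that vanishes on `I`. -/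
def ofQuot (e : MVHom A B) (I : MVIdeal A) (h : ∀ a ∈ I, e a = 0) : MVHom I.Quot B where
  toFun := Quotient.lift e fun a b hab => distance_eq_zero.1 (by
    rw [← e.map_distance]
    exact h _ hab)
  map_zero' := e.map_zero
  map_add' := by rintro ⟨x⟩ ⟨y⟩; exact e.map_add x y
  map_compl' := by rintro ⟨x⟩; exact e.map_compl x

/-- The kernel is a proper ideal of a simple algebra. -/
theorem eq_zero_of_isSimple (f : MVHom A B) (hA : IsSimple A) (hB : (0 : B)ᶜ ≠ 0) {a : A}
    (ha : f a = 0) : a = 0 :=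
  hA.2 (MVIdeal.comap f (MVIdeal.zeroIdeal B)) (fun h => hB (by
    rw [← f.map_zero, ← f.map_compl]
    exact h.trans f.map_zero.symm)) a ha

end MVHom

/-! ### Recovering an mv-space from its global sections -/

namespace MVSpace

variable {X Y : MVSpace.{u}}

/-- Testing stalk maps on values of global sections keeps the compared elements in the stalk of `X`
at `x`, so nothing has to be transported along the equality of base maps. -/
theorem Hom.ext_of_globalSection {ι : Type*} (T : ι → Y.GlobalSection)
    (hT : ∀ (y : Y.carrier) (e : Y.stalk y), ∃ i, (T i).1 y = e) {F G : Hom X Y}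
    (hbase : ∀ x, F.base x = G.base x)
    (h : ∀ i x, F.stalkMap x ((T i).1 (F.base x)) = G.stalkMap x ((T i).1 (G.base x))) :
    F = G := by
  obtain ⟨f, φ, hf⟩ := F
  obtain ⟨g, ψ, hg⟩ := G
  obtain rfl : f = g := ContinuousMap.ext hbase
  refine Hom.ext' rfl fun x => heq_of_eq (MVHom.ext fun e => ?_)
  obtain ⟨i, rfl⟩ := hT _ e
  exact h i x

theorem continuous_of_eventually_eq {α : Type*} [TopologicalSpace α] {f : α → X.carrier}
    (hf : Continuous f) {s : ∀ a, X.stalk (f a)}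
    (h : ∀ a, ∃ t : X.GlobalSection, ∀ᶠ b in nhds a, s b = t.1 (f b)) :
    Continuous (fun a => (⟨f a, s a⟩ : X.Total)) := by
  refine continuous_iff_continuousAt.2 fun a => ?_
  obtain ⟨t, ht⟩ := h a
  refine (t.2.comp hf).continuousAt.congr ?_
  filter_upwards [ht] with b hb
  exact congrArg (Sigma.mk (f b)) hb.symm

/-- The projection of an étale space is locally injective, so two lifts of one map that agree at a
point agree nearby. -/
theorem isOpen_setOf_eq {α : Type*} [TopologicalSpace α] {f : α → X.carrier}
    {s t : ∀ a, X.stalk (f a)} (hs : Continuous (fun a => (⟨f a, s a⟩ : X.Total)))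
    (ht : Continuous (fun a => (⟨f a, t a⟩ : X.Total))) : IsOpen {a | s a = t a} := by
  convert X.isLocalHomeomorph_proj.isLocallyInjective.isOpen_eqLocus hs ht rfl using 3 with a
  exact ⟨fun h => congrArg (Sigma.mk (f a)) h, fun h => eq_of_heq (Sigma.mk.inj h).2⟩

/-- The value of global sections at a point. -/
def evalHom (X : MVSpace.{u}) (x : X.carrier) : MVHom X.GlobalSection (X.stalk x) where
  toFun s := s.1 x
  map_zero' := rfl
  map_add' _ _ := rfl
  map_compl' _ := rfl

theorem nsmul_apply (n : ℕ) (s : X.GlobalSection) (x : X.carrier) : (n • s).1 x = n • s.1 x :=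
  (X.evalHom x).map_nsmul n s

theorem isOpen_setOf_globalSection_eq (s t : X.GlobalSection) : IsOpen {x | s.1 x = t.1 x} :=
  isOpen_setOf_eq (f := id) s.2 t.2

/-- Sections over a compact space with hyperarchimedean fibers form a hyperarchimedean algebra. -/
theorem isHyperarchimedean_globalSection [CompactSpace X.carrier]
    (hX : ∀ x, IsHyperarchimedean (X.stalk x)) : IsHyperarchimedean X.GlobalSection := by
  intro s
  -- The sets where `n • s` has stabilized are open, increase with `n` and cover the compact space,
  -- so a single `n` serves all points.
  obtain ⟨n, hn⟩ := (isCompact_univ (X := X.carrier)).elim_directed_cover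
    (fun n : ℕ => {x | (n • s).1 x = ((n + 1) • s).1 x})
    (fun n => isOpen_setOf_globalSection_eq _ _)
    (fun x _ => by
      obtain ⟨n, -, h⟩ := hX x (s.1 x)
      refine Set.mem_iUnion.2 ⟨n, ?_⟩
      change (n • s).1 x = ((n + 1) • s).1 x
      rw [nsmul_apply, nsmul_apply, h])
    (directed_of_isDirected_le fun n m hnm x hx => by
      change (n • s).1 x = ((n + 1) • s).1 x at hx
      change (m • s).1 x = ((m + 1) • s).1 x
      rw [nsmul_apply, nsmul_apply] at hx ⊢
      exact nsmul_eq_of_le hx hnm)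
  have h : n • s = (n + 1) • s := Subtype.ext (funext fun x => hn trivial)
  -- The cover may yield `n = 0`; passing to `n + 1` secures an exponent at least `1`.
  exact ⟨n + 1, Nat.le_add_left 1 n, nsmul_eq_of_le h (Nat.le_succ n)⟩

theorem globalHausdorffStone.isHyperarchimedean (hX : globalHausdorffStone X) :
    IsHyperarchimedean X.GlobalSection :=
  have := hX.1.1
  isHyperarchimedean_globalSection fun x => (hX.2.2.1 x).isHyperarchimedean

/-- The prime ideal of the global sections that vanish at a point. -/
def vanishing (X : MVSpace.{u}) (x : X.carrier) : MVSpec X.GlobalSection where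
  val := MVIdeal.comap (X.evalHom x) (MVIdeal.zeroIdeal _)
  property := by
    refine MVIdeal.IsPrime.comap ⟨(X.isChain x).1, fun a b => ?_⟩ _
    exact ((X.isChain x).2 a b).imp (le_iff_ominus a b).1 (le_iff_ominus b a).1

theorem mem_vanishing {x : X.carrier} {s : X.GlobalSection} :
    s ∈ (X.vanishing x).1 ↔ s.1 x = 0 := Iff.rfl

theorem continuous_vanishing (X : MVSpace.{u}) : Continuous X.vanishing := by
  refine continuous_generateFrom_iff.2 ?_
  rintro _ ⟨s, rfl⟩
  exact isOpen_setOf_globalSection_eq s 0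

theorem exists_section_of_isClopen {U : Set X.carrier} (hU : IsClopen U) :
    ∃ s : X.GlobalSection, (∀ x ∈ U, s.1 x = 0) ∧ ∀ x ∉ U, s.1 x = 0ᶜ := by
  classical
  refine ⟨⟨fun x => if x ∈ U then 0 else 0ᶜ,
    continuous_of_eventually_eq (f := id) continuous_id fun x => ?_⟩, fun x hx => if_pos hx,
    fun x hx => if_neg hx⟩
  by_cases hx : x ∈ U
  · refine ⟨0, ?_⟩
    filter_upwards [hU.2.mem_nhds hx] with y hy
    exact if_pos hy
  · refine ⟨0ᶜ, ?_⟩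
    filter_upwards [hU.compl.2.mem_nhds hx] with y hy
    exact if_neg hy

/-- A clopen set separating two points yields a section that is `0` at one and `1` at the other. -/
theorem globalHausdorffStone.vanishing_injective (hX : globalHausdorffStone X) :
    Function.Injective X.vanishing := by
  intro x y h
  by_contra hxy
  have := hX.1.2.1
  obtain ⟨U, hU, hxU, hUy⟩ := hX.1.2.2.exists_subset_of_mem_open (u := {y}ᶜ) hxy isOpen_ne
  obtain ⟨s, h0, h1⟩ := exists_section_of_isClopen (X := X) hU
  have hs : s ∈ (X.vanishing y).1 := h ▸ mem_vanishing.2 (h0 x hxU)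
  exact (X.isChain y).1 ((h1 y fun hy => hUy hy rfl).symm.trans (mem_vanishing.1 hs))

/-- Over a compact space with simple fibers, the members of a proper ideal of global sections
have a common zero. -/
theorem exists_forall_mem_eq_zero [CompactSpace X.carrier] (hX : ∀ x, IsSimple (X.stalk x))
    {I : MVIdeal X.GlobalSection} (hI : (0 : X.GlobalSection)ᶜ ∉ I) :
    ∃ x, ∀ s ∈ I, s.1 x = 0 := by
  by_contra! h
  -- Without a common zero, each point has a member of `I` nonzero there. By simplicity a multiple
  -- of it is `1` at that point, hence nearby, and a finite sum of such multiples is `1` everywhere.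
  have key : ∃ s ∈ I, ∀ x ∈ (Set.univ : Set X.carrier), s.1 x = 0ᶜ := by
    refine isCompact_univ.induction_on (p := fun S => ∃ s ∈ I, ∀ x ∈ S, s.1 x = 0ᶜ)
      ⟨0, I.zero_mem, fun x hx => absurd hx (Set.notMem_empty x)⟩ ?_ ?_ ?_
    · rintro S T hST ⟨s, hs, h1⟩
      exact ⟨s, hs, fun x hx => h1 x (hST hx)⟩
    · rintro S T ⟨s, hs, h1⟩ ⟨t, ht, h2⟩
      refine ⟨s + t, I.add_mem hs ht, ?_⟩
      rintro x (hx | hx)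
      · change s.1 x + t.1 x = 0ᶜ
        rw [h1 x hx, add_comm, add_one]
      · change s.1 x + t.1 x = 0ᶜ
        rw [h2 x hx, add_one]
    · intro x _
      obtain ⟨s, hs, h0⟩ := h x
      obtain ⟨n, -, hn⟩ := (hX x).exists_nsmul_eq_one h0
      refine ⟨{y | (n • s).1 y = (0ᶜ : X.GlobalSection).1 y}, mem_nhdsWithin_of_mem_nhds
        ((isOpen_setOf_globalSection_eq _ _).mem_nhds ?_), n • s, I.nsmul_mem hs n,
        fun y hy => hy⟩
      exact (nsmul_apply n s x).trans hn
  obtain ⟨s, hs, h1⟩ := key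
  obtain rfl : s = 0ᶜ := Subtype.ext (funext fun x => h1 x trivial)
  exact hI hs

/-- A common zero `x` of `P` gives one inclusion. If `s` vanishes at `x` and `n • s` is idempotent,
then `¬(n • s)` is `1` at `x`, so it is not in `P`; hence `n • s`, and so `s`, is in `P`. -/
theorem globalHausdorffStone.vanishing_surjective (hX : globalHausdorffStone X) :
    Function.Surjective X.vanishing := by
  intro P
  have := hX.1.1
  obtain ⟨x, hx⟩ := exists_forall_mem_eq_zero hX.2.2.1 P.2.1
  refine ⟨x, Subtype.ext (MVIdeal.ext fun s => ⟨fun hs => ?_, hx s⟩)⟩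
  obtain ⟨n, hn, hb⟩ := hX.isHyperarchimedean.exists_idem s
  refine (P.1.nsmul_mem_iff hn).1 ((P.2.mem_or_compl_mem hb).resolve_right fun h => ?_)
  exact MVIdeal.compl_notMem (X.vanishing x).2.1 ((X.vanishing x).1.nsmul_mem hs n) (hx _ h)

/-- The base of a global Hausdorff sheaf of simple MV-algebras over a Stone space is the prime
spectrum of the algebra of global sections. -/
noncomputable def globalHausdorffStone.homeomorph (hX : globalHausdorffStone X) :
    X.carrier ≃ₜ MVSpec X.GlobalSection :=
  have := hX.1.1
  have := MVSpec.t2Space hX.isHyperarchimedean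
  Continuous.homeoOfEquivCompactToT2
    (f := Equiv.ofBijective _ ⟨hX.vanishing_injective, hX.vanishing_surjective⟩)
    X.continuous_vanishing

theorem globalHausdorffStone.vanishing_symm_apply (hX : globalHausdorffStone X)
    (P : MVSpec X.GlobalSection) : X.vanishing (hX.homeomorph.symm P) = P :=
  hX.homeomorph.apply_symm_apply P

theorem globalHausdorffStone.symm_apply_vanishing (hX : globalHausdorffStone X)
    (x : X.carrier) : hX.homeomorph.symm (X.vanishing x) = x :=
  hX.homeomorph.symm_apply_apply x

/-- The canonical morphism `X → Spec(Γ(X))`. -/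
def toSpec (X : MVSpace.{u}) : Hom X (MVSpec.space X.GlobalSection) where
  base := ⟨X.vanishing, X.continuous_vanishing⟩
  stalkMap x := (X.evalHom x).ofQuot _ fun _ h => h
  isSection V s hs := by
    refine continuous_of_eventually_eq continuous_subtype_val fun x => ?_
    have hc : Continuous (fun y : V.comap ⟨X.vanishing, X.continuous_vanishing⟩ =>
        (⟨X.vanishing y.1, y.2⟩ : V)) :=
      (X.continuous_vanishing.comp continuous_subtype_val).subtype_mk _
    obtain ⟨t, ht⟩ := (MVSpec.continuous_iff V s).1 hs ⟨X.vanishing x.1, x.2⟩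
    refine ⟨t, ?_⟩
    filter_upwards [hc.continuousAt.eventually ht] with y hy
    exact congrArg ((X.evalHom y.1).ofQuot (X.vanishing y.1).1 fun _ h => h) hy

theorem globalHausdorffStone.evalHom_surjective (hX : globalHausdorffStone X) (x : X.carrier) :
    Function.Surjective (X.evalHom x) := hX.2.2.2 x

theorem globalHausdorffStone.mem_of_apply_symm_eq_zero (hX : globalHausdorffStone X)
    (P : MVSpec X.GlobalSection) (s : X.GlobalSection)
    (hs : X.evalHom (hX.homeomorph.symm P) s = 0) : s ∈ P.1 := by
  rw [← hX.vanishing_symm_apply P]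
  exact hs

/-- The inverse of the canonical morphism `X → Spec(Γ(X))`. -/
noncomputable def globalHausdorffStone.ofSpec (hX : globalHausdorffStone X) :
    Hom (MVSpec.space X.GlobalSection) X where
  base := ⟨hX.homeomorph.symm, hX.homeomorph.symm.continuous⟩
  stalkMap P := (X.evalHom (hX.homeomorph.symm P)).descend (hX.evalHom_surjective _) P.1
    (hX.mem_of_apply_symm_eq_zero P)
  isSection V s hs := by
    refine (MVSpec.continuous_iff _ _).2 fun P => ?_
    obtain ⟨t, ht⟩ := hX.evalHom_surjective _ (s ⟨hX.homeomorph.symm P.1, P.2⟩)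
    refine ⟨t, ?_⟩
    have hc : Continuous (fun Q : V.comap ⟨hX.homeomorph.symm, hX.homeomorph.symm.continuous⟩ =>
        (⟨hX.homeomorph.symm Q.1, Q.2⟩ : V)) :=
      (hX.homeomorph.symm.continuous.comp continuous_subtype_val).subtype_mk _
    -- The section `s` agrees with the global section `t` at one point, hence on an open set; over
    -- its preimage the image of `s` is the class of `t`.
    have ho : IsOpen {y : V | s y = t.1 y} :=
      isOpen_setOf_eq (f := Subtype.val) hs (t.2.comp continuous_subtype_val)
    filter_upwards [hc.continuousAt.eventually (ho.mem_nhds ht.symm)] with Q hQ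
    refine Eq.trans (congrArg _ hQ) ?_
    exact MVHom.descend_apply _ _ _ (hX.mem_of_apply_symm_eq_zero Q.1) t

theorem globalHausdorffStone.ofSpec_stalkMap (hX : globalHausdorffStone X)
    (P : MVSpec X.GlobalSection) (s : X.GlobalSection) :
    hX.ofSpec.stalkMap P (s.1 (hX.homeomorph.symm P)) = P.1.cls s :=
  MVHom.descend_apply _ _ _ (hX.mem_of_apply_symm_eq_zero P) s

/-- `X` is isomorphic to `Spec(Γ(X))`. -/
noncomputable def globalHausdorffStone.isoSpec (hX : globalHausdorffStone X) :
    X ≅ Spec.obj (op (Gamma.obj (op X))) where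
  hom := toSpec X
  inv := hX.ofSpec
  hom_inv_id := by
    refine Hom.ext_of_globalSection (fun s => s) hX.2.2.2 hX.symm_apply_vanishing fun s x => ?_
    exact congrArg ((toSpec X).stalkMap x) (hX.ofSpec_stalkMap (X.vanishing x) s)
  inv_hom_id := by
    refine Hom.ext_of_globalSection (MVSpec.toSections _)
      (fun P e => P.1.cls_surjective e) hX.vanishing_symm_apply fun s P => ?_
    exact hX.ofSpec_stalkMap P s

/-- On points this says that a section vanishes at `F.base x` iff its pullback vanishes at `x`,
which is injectivity of the stalk map on the simple stalk of `Y`. On germs of global sections both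
sides agree by definition. -/
theorem globalHausdorffStone.toSpec_naturality (hX : globalHausdorffStone X)
    (hY : globalHausdorffStone Y) (F : X ⟶ Y) :
    F ≫ hY.isoSpec.hom = hX.isoSpec.hom ≫ Spec.map (Gamma.map F.op).op := by
  refine Hom.ext_of_globalSection (MVSpec.toSections _) (fun P e => P.1.cls_surjective e)
    (fun x => Subtype.ext (MVIdeal.ext fun s => ?_)) fun s x => rfl
  change s.1 (F.base x) = 0 ↔ F.stalkMap x (s.1 (F.base x)) = 0
  refine ⟨fun h => by rw [h, MVHom.map_zero], fun h => ?_⟩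
  exact (F.stalkMap x).eq_zero_of_isSimple (hY.2.2.1 _) (X.isChain x).1 h

end MVSpace

/-- A hyperarchimedean algebra `A` is isomorphic to `Γ(Spec(A))`. -/
noncomputable def MVAlgCat.hyperarchimedean.isoGamma {A : MVAlgCat.{u}}
    (hA : MVAlgCat.hyperarchimedean A) :
    A ≅ MVSpace.Gamma.obj (op (MVSpace.Spec.obj (op A))) where
  hom := MVSpec.toSections A.carrier
  inv := (MVSpec.toSections A.carrier).symmOfBijective (MVSpec.toSections_bijective hA)
  hom_inv_id := MVHom.ext fun a => MVHom.symmOfBijective_apply _ _ a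
  inv_hom_id := MVHom.ext fun s =>
    MVHom.apply_symmOfBijective _ (MVSpec.toSections_bijective hA) s

theorem MVAlgCat.hyperarchimedean.isoGamma_naturality {A B : MVAlgCat.{u}}
    (hA : MVAlgCat.hyperarchimedean A) (hB : MVAlgCat.hyperarchimedean B) (f : A ⟶ B) :
    hA.isoGamma.hom ≫ MVSpace.Gamma.map (MVSpace.Spec.map f.op).op = f ≫ hB.isoGamma.hom :=
  rfl

theorem theorem5 :
    ∃ (hSpec : ∀ A : MVAlgCat.{u}, MVAlgCat.hyperarchimedean A →
        MVSpace.globalHausdorffStone (MVSpace.Spec.obj (op A)))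
      (hGamma : ∀ X : MVSpace.{u}, MVSpace.globalHausdorffStone X →
        MVAlgCat.hyperarchimedean (MVSpace.Gamma.obj (op X)))
      (e : (MVAlgCat.hyperarchimedean.{u}.FullSubcategory)ᵒᵖ ≌
        MVSpace.globalHausdorffStone.{u}.FullSubcategory),
      e.functor = MVSpace.SpecRestrict hSpec ∧
      e.inverse = (MVSpace.GammaRestrict hGamma).rightOp := by
  have hSpec : ∀ A : MVAlgCat.{u}, MVAlgCat.hyperarchimedean A →
      MVSpace.globalHausdorffStone (MVSpace.Spec.obj (op A)) :=
    fun A hA => MVSpec.globalHausdorffStone_space hA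
  have hGamma : ∀ X : MVSpace.{u}, MVSpace.globalHausdorffStone X →
      MVAlgCat.hyperarchimedean (MVSpace.Gamma.obj (op X)) :=
    fun X hX => hX.isHyperarchimedean
  -- `Equivalence.mk` adjusts only the unit to obtain the triangle identity, so both functor
  -- equalities hold by `rfl`.
  refine ⟨hSpec, hGamma, CategoryTheory.Equivalence.mk (MVSpace.SpecRestrict hSpec)
    (MVSpace.GammaRestrict hGamma).rightOp
    (NatIso.ofComponents (F := MVSpace.SpecRestrict hSpec ⋙ (MVSpace.GammaRestrict hGamma).rightOp)
      (fun A => Iso.op (ObjectProperty.isoMk _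
        (MVAlgCat.hyperarchimedean.isoGamma A.unop.property))) fun {A B} f => ?_).symm
    (NatIso.ofComponents (G := (MVSpace.GammaRestrict hGamma).rightOp ⋙ MVSpace.SpecRestrict hSpec)
      (fun X => ObjectProperty.isoMk _
        (MVSpace.globalHausdorffStone.isoSpec X.property)) fun {X Y} F => ?_).symm, rfl, rfl⟩
  · exact Quiver.Hom.unop_inj (ObjectProperty.hom_ext _ <|
      MVAlgCat.hyperarchimedean.isoGamma_naturality B.unop.property
        A.unop.property f.unop.hom)
  · exact ObjectProperty.hom_ext _ (X.property.toSpec_naturality Y.property F.hom)
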